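/- Let $\Phi(\xi)=|\xi|^{1/2}$ for $\xi\in\mathbb{R}$. For $t\in\mathbb{R}$ and $\varphi$ in the Schwartz space $\mathcal{S}(\mathbb{R})$ of complex-valued functions, define $e^{it\Phi(D)}\varphi$ by $\widehat{e^{it\Phi(D)}\varphi}(\xi)=e^{it\Phi(\xi)}\widehat{\varphi}(\xi)$, where $\widehat{\varphi}(\xi)=\int_{\mathbb{R}}e^{-ix\xi}\varphi(x)\,dx$; that is, $e^{it\Phi(D)}\varphi(x)=\frac{1}{2\pi}\int_{\mathbb{R}}e^{i(x\xi+t|\xi|^{1/2})}\widehat{\varphi}(\xi)\,d\xi$. Then there exists a constant $C>0$ such that for every $t\in\mathbb{R}$ and every $\varphi\in\mathcal{S}(\mathbb{R})$, $$\lVert e^{it\Phi(D)}\varphi\rVert_{L^\infty(\mathbb{R})}\leq C(1+|t|)^{-1/2}\Big(\lVert\varphi\rVert_{H^1(\mathbb{R})}+\lVert x\,\partial_x\varphi\rVert_{L^2(\mathbb{R})}\Big),$$ where $\lVert\varphi\rVert_{H^1}=(\lVert\varphi\rVert_{L^2}^2+\lVert\partial_x\varphi\rVert_{L^2}^2)^{1/2}$.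 -/

import Mathlib

open MeasureTheory
open scoped FourierTransform ENNReal SchwartzMap

noncomputable section

namespace WaterWave

/-- The phase function `Φ(ξ) = |ξ|^{1/2}`. -/
def Phi (ξ : ℝ) : ℝ := |ξ| ^ (1 / 2 : ℝ)

/-- The Fourier multiplier `m(D)`, `D = -i d/dx`, applied to a function `f`. Mathlib's transform
`𝓕 f w = ∫ e^{-2πixw} f(x) dx` uses the frequency variable `w = ξ / (2π)`, so the symbol `m(ξ)`
is evaluated at `ξ = 2πw`; equivalently
`m(D)f(x) = (2π)⁻¹ ∫ e^{ixξ} m(ξ) (∫ e^{-iyξ} f(y) dy) dξ`. -/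
def fourierMultiplier (m : ℝ → ℂ) (f : ℝ → ℂ) : ℝ → ℂ :=
  𝓕⁻ (fun w : ℝ => m (2 * Real.pi * w) * 𝓕 f w)

/-- The operator `e^{itΦ(D)}` on Schwartz functions. -/
def propagator (t : ℝ) (φ : 𝓢(ℝ, ℂ)) : ℝ → ℂ :=
  fourierMultiplier (fun ξ => Complex.exp (Complex.I * t * Phi ξ)) φ

/-- The `H¹(ℝ)` norm `(‖φ‖_{L²}² + ‖∂ₓφ‖_{L²}²)^{1/2}`. -/
def h1Norm (φ : 𝓢(ℝ, ℂ)) : ℝ≥0∞ :=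
  (eLpNorm φ 2 volume ^ 2 + eLpNorm (deriv φ) 2 volume ^ 2) ^ (1 / 2 : ℝ)

/-- The weighted norm `‖x ∂ₓφ‖_{L²}`. -/
def weightedNorm (φ : 𝓢(ℝ, ℂ)) : ℝ≥0∞ :=
  eLpNorm (fun x : ℝ => (x : ℂ) * deriv φ x) 2 volume

/-- The function whose inverse transform defines `e^{itΦ(D)}φ` is integrable. -/
theorem integrable_symbol_mul_fourier (t : ℝ) (φ : 𝓢(ℝ, ℂ)) :
    Integrable (fun w : ℝ =>
      Complex.exp (Complex.I * t * Phi (2 * Real.pi * w)) * 𝓕 (φ : ℝ → ℂ) w) := by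
  have h : Integrable (𝓕 (φ : ℝ → ℂ)) := by
    rw [← SchwartzMap.fourier_coe]; exact (𝓕 φ).integrable
  refine h.bdd_mul (c := 1) ?_ (Filter.Eventually.of_forall fun w => ?_)
  · refine Continuous.aestronglyMeasurable ?_
    unfold Phi
    have : Continuous fun w : ℝ => |2 * Real.pi * w| ^ (1 / 2 : ℝ) :=
      Continuous.rpow_const (by fun_prop) (fun _ => Or.inr (by norm_num))
    fun_prop
  · rw [show Complex.I * (t : ℂ) * (Phi (2 * Real.pi * w) : ℂ)
      = ((t * Phi (2 * Real.pi * w) : ℝ) : ℂ) * Complex.I by push_cast; ring]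
    rw [Complex.norm_exp_ofReal_mul_I]

/-- The Fourier transform of `e^{itΦ(D)}φ`, as a tempered distribution, is the function
`e^{itΦ} 𝓕φ`: the two agree when paired with an arbitrary Schwartz function `g`. -/
theorem fourier_propagator (t : ℝ) (φ g : 𝓢(ℝ, ℂ)) :
    ∫ x : ℝ, propagator t φ x * 𝓕 (g : ℝ → ℂ) x =
      ∫ w : ℝ, Complex.exp (Complex.I * t * Phi (2 * Real.pi * w)) *
        𝓕 (φ : ℝ → ℂ) w * g w := by
  have hF := integrable_symbol_mul_fourier t φ
  have hg : Integrable (𝓕 (g : ℝ → ℂ)) := by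
    rw [← SchwartzMap.fourier_coe]; exact (𝓕 g).integrable
  have key := VectorFourier.integral_fourierIntegral_smul_eq_flip (μ := volume) (ν := volume)
    (L := -innerₗ ℝ) Real.continuous_fourierChar
    (show Continuous fun p : ℝ × ℝ => (-innerₗ ℝ) p.1 p.2 from continuous_inner.neg) hF hg
  have hflip : (-innerₗ ℝ : ℝ →ₗ[ℝ] ℝ →ₗ[ℝ] ℝ).flip = -innerₗ ℝ := by
    ext
    simp
  rw [hflip] at key
  have hinv : VectorFourier.fourierIntegral Real.fourierChar volume (-innerₗ ℝ)
      (𝓕 (g : ℝ → ℂ)) = g :=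
    g.continuous.fourierInv_fourier_eq g.integrable hg
  rw [hinv] at key
  exact key

end WaterWave

end

noncomputable section

namespace WaterWave

open Set

/-! On each half-line put `|w| = η²`. The phase `2πxw + t|2πw|^{1/2}` becomes the quadratic `Xη² +
τη` with `τ = √(2π) t`, and the Jacobian supplies a factor `η` that makes the amplitude `g(η) = η
F(η²)/(2M)` vanish at the origin. Plancherel, together with the identity expressing `w F'` through
the transforms of `φ` and `x φ'`, bounds the energy of `g` by the norms in the theorem.

Completing the square, the phase is `X(η² - 2cη)` with `|2X||c| = |τ|`. Set `s = √|τ|`, with `s ≥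
1`. The energy makes the `L¹` mass of `g` on `η < 1/s` and on `η > s` at most `1/s`, and `|g| ≤ 1`
handles the window `|η - c| < 1/s`. Elsewhere one integrates by parts. Although `X` depends on `x`,
the product `|X||c|` does not, so `1/|2X| = |c|/s² ≤ (|η - c| + η)/s²`, which gives bounds uniform
in `x`. Every piece is `O(1/s) = O(|τ|^{-1/2})`; for `|τ| ≤ 1` the `L¹` bound on `g` suffices. -/

/-- Scale-invariant energy density controlling the amplitude `g` on the half-line. -/
def energyDensity (g : ℝ → ℂ) (η : ℝ) : ℝ :=
  ‖g η‖ ^ 2 / η + ‖g η‖ ^ 2 * η ^ 3 + η * ‖deriv g η‖ ^ 2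

/-- A `C¹` amplitude vanishing at the origin whose energy on the half-line is at most one. -/
structure UnitEnergy (g : ℝ → ℂ) : Prop where
  contDiff : ContDiff ℝ 1 g
  zero : g 0 = 0
  integrable : IntegrableOn (energyDensity g) (Ioi 0)
  le_one : ∫ η in Ioi 0, energyDensity g η ≤ 1

theorem energyDensity_nonneg (g : ℝ → ℂ) {η : ℝ} (hη : 0 ≤ η) : 0 ≤ energyDensity g η := by
  unfold energyDensity; positivity

/-! ### Pointwise and `L¹` bounds for amplitudes of unit energy -/

namespace UnitEnergy

variable {g : ℝ → ℂ} (hg : UnitEnergy g)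
include hg

theorem hasDerivAt (η : ℝ) : HasDerivAt g (deriv g η) η :=
  (hg.contDiff.differentiable (by norm_num) η).hasDerivAt

theorem continuous_deriv : Continuous (deriv g) :=
  hg.contDiff.continuous_deriv (by norm_num)

theorem setIntegral_le_one {s : Set ℝ} (hs : s ⊆ Ioi 0) : ∫ η in s, energyDensity g η ≤ 1 :=
  (setIntegral_mono_set hg.integrable
    ((ae_restrict_iff' measurableSet_Ioi).2 (.of_forall fun _ h =>
      energyDensity_nonneg g (mem_Ioi.1 h).le)) (LE.le.eventuallyLE hs)).trans hg.le_one

theorem intervalIntegrable {a b : ℝ} (ha : 0 ≤ a) (hab : a ≤ b) :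
    IntervalIntegrable (energyDensity g) volume a b :=
  (intervalIntegrable_iff_integrableOn_Ioc_of_le hab).2
    (hg.integrable.mono_set fun _ hx => ha.trans_lt hx.1)

theorem intervalIntegral_le_one {a b : ℝ} (ha : 0 ≤ a) (hab : a ≤ b) :
    ∫ η in a..b, energyDensity g η ≤ 1 := by
  rw [intervalIntegral.integral_of_le hab]
  exact hg.setIntegral_le_one fun _ hx => ha.trans_lt hx.1

/-- Integrate `(|g|²)'` from `0`: by AM-GM, `2|g||g'| ≤ |g|²/η + η|g'|²`. -/
theorem norm_le_one {η : ℝ} (hη : 0 ≤ η) : ‖g η‖ ≤ 1 := by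
  have hd : ∀ x ∈ uIcc 0 η, HasDerivAt (fun x => ‖g x‖ ^ 2) (2 * inner ℝ (g x) (deriv g x)) x :=
    fun x _ => (hg.hasDerivAt x).norm_sq
  have hc := hg.contDiff.continuous
  have hc' := hg.continuous_deriv
  have hint := intervalIntegral.integral_eq_sub_of_hasDerivAt hd
    (Continuous.intervalIntegrable (by fun_prop) _ _)
  have hb := intervalIntegral.norm_integral_le_of_norm_le (μ := volume)
    (f := fun x => 2 * inner ℝ (g x) (deriv g x)) hη
    (.of_forall fun x hx => ?_) (hg.intervalIntegrable le_rfl hη)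
  · rw [hint, hg.zero] at hb
    have := hg.intervalIntegral_le_one le_rfl hη
    simp only [norm_zero, ne_eq, OfNat.ofNat_ne_zero, not_false_eq_true, zero_pow, sub_zero,
      norm_pow, norm_norm] at hb
    exact (sq_le_one_iff₀ (norm_nonneg _)).1 (hb.trans this)
  · have hx0 : 0 < x := hx.1
    rw [norm_mul, Real.norm_ofNat]
    have h1 : ‖inner ℝ (g x) (deriv g x)‖ ≤ ‖g x‖ * ‖deriv g x‖ := norm_inner_le_norm _ _
    have h2 : ‖g x‖ ^ 2 / x + x * ‖deriv g x‖ ^ 2 - 2 * (‖g x‖ * ‖deriv g x‖)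
        = (‖g x‖ - x * ‖deriv g x‖) ^ 2 / x := by field_simp; ring
    have h3 : 0 ≤ (‖g x‖ - x * ‖deriv g x‖) ^ 2 / x := by positivity
    have h4 : 0 ≤ ‖g x‖ ^ 2 * x ^ 3 := by positivity
    unfold energyDensity
    linarith

/-- Same argument for `η²|g|²`, whose derivative is at most twice the energy density; the constant
`2` rounds up `√2`. -/
theorem mul_norm_le_two {η : ℝ} (hη : 0 ≤ η) : η * ‖g η‖ ≤ 2 := by
  have hd : ∀ x ∈ uIcc 0 η, HasDerivAt (fun x => x ^ 2 * ‖g x‖ ^ 2)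
      (2 * x * ‖g x‖ ^ 2 + x ^ 2 * (2 * inner ℝ (g x) (deriv g x))) x := fun x _ => by
    simpa using (hasDerivAt_pow 2 x).fun_mul (hg.hasDerivAt x).norm_sq
  have hc := hg.contDiff.continuous
  have hc' := hg.continuous_deriv
  have hint := intervalIntegral.integral_eq_sub_of_hasDerivAt hd
    (Continuous.intervalIntegrable (by fun_prop) _ _)
  have hb := intervalIntegral.norm_integral_le_of_norm_le (μ := volume)
    (f := fun x => 2 * x * ‖g x‖ ^ 2 + x ^ 2 * (2 * inner ℝ (g x) (deriv g x))) hη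
    (.of_forall fun x hx => ?_) ((hg.intervalIntegrable le_rfl hη).const_mul 2)
  · rw [hint, hg.zero, intervalIntegral.integral_const_mul] at hb
    have := hg.intervalIntegral_le_one le_rfl hη
    have h1 := le_abs_self (η ^ 2 * ‖g η‖ ^ 2)
    simp only [norm_zero, ne_eq, OfNat.ofNat_ne_zero, not_false_eq_true, zero_pow, sub_zero,
      mul_zero, Real.norm_eq_abs] at hb
    refine abs_le_of_sq_le_sq' ?_ (by norm_num) |>.2
    rw [mul_pow]; linarith
  · have hx0 : 0 < x := hx.1
    have h1 : ‖inner ℝ (g x) (deriv g x)‖ ≤ ‖g x‖ * ‖deriv g x‖ := norm_inner_le_norm _ _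
    refine (norm_add_le _ _).trans ?_
    rw [norm_mul (x ^ 2), norm_mul 2 (inner ℝ _ _), Real.norm_ofNat,
      Real.norm_of_nonneg (by positivity), Real.norm_of_nonneg (by positivity)]
    have h2 : x ^ 2 * (2 * ‖inner ℝ (g x) (deriv g x)‖) ≤
        x ^ 2 * (2 * (‖g x‖ * ‖deriv g x‖)) := by gcongr
    have h3 : ‖g x‖ ^ 2 / x + ‖g x‖ ^ 2 * x ^ 3 - 2 * x * ‖g x‖ ^ 2
        = ‖g x‖ ^ 2 * (1 - x ^ 2) ^ 2 / x := by field_simp; ring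
    have h4 : 0 ≤ ‖g x‖ ^ 2 * (1 - x ^ 2) ^ 2 / x := by positivity
    have h5 : 0 ≤ x * (x * ‖g x‖ - ‖deriv g x‖) ^ 2 := by positivity
    have h6 : 0 ≤ ‖g x‖ ^ 2 / x := by positivity
    have h7 : 0 ≤ x * ‖deriv g x‖ ^ 2 := by positivity
    unfold energyDensity
    linarith

/-- The low-frequency part of the amplitude is small in `L¹`. -/
theorem integral_norm_le_inv {s : ℝ} (hs : 0 < s) :
    ∫ η in (0)..s⁻¹, ‖g η‖ ≤ s⁻¹ := by
  have h0 : 0 ≤ s⁻¹ := by positivity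
  have hc := hg.contDiff.continuous
  have hi := hg.intervalIntegrable le_rfl h0
  have hb : ∫ η in (0)..s⁻¹, ‖g η‖ ≤
      ∫ η in (0)..s⁻¹, (s⁻¹ / 2 * energyDensity g η + s / 2 * η) := by
    refine intervalIntegral.integral_mono_on_of_le_Ioo h0 (hc.norm.intervalIntegrable _ _)
      ((hi.const_mul _).add (Continuous.intervalIntegrable (by fun_prop) _ _)) fun x hx => ?_
    have hx0 : 0 < x := hx.1
    -- AM-GM with weight `s`; after integration the two terms contribute `s⁻¹/2` and `s⁻¹/4`.
    have h1 : s⁻¹ / 2 * (‖g x‖ ^ 2 / x) + s / 2 * x - ‖g x‖ =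
        (‖g x‖ - s * x) ^ 2 / (2 * s * x) := by field_simp; ring
    have h2 : 0 ≤ (‖g x‖ - s * x) ^ 2 / (2 * s * x) := by positivity
    have h3 : 0 ≤ s⁻¹ / 2 * (‖g x‖ ^ 2 * x ^ 3) := by positivity
    have h4 : 0 ≤ s⁻¹ / 2 * (x * ‖deriv g x‖ ^ 2) := by positivity
    unfold energyDensity
    linarith
  rw [intervalIntegral.integral_add (hi.const_mul _)
    (Continuous.intervalIntegrable (by fun_prop) _ _), intervalIntegral.integral_const_mul,
    intervalIntegral.integral_const_mul, integral_id] at hb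
  have h1 := hg.intervalIntegral_le_one le_rfl h0
  have h2 : s⁻¹ / 2 * ∫ η in (0)..s⁻¹, energyDensity g η ≤ s⁻¹ / 2 * 1 := by gcongr
  have h3 : s / 2 * ((s⁻¹ ^ 2 - 0 ^ 2) / 2) = s⁻¹ / 4 := by field_simp; ring
  linarith

/-- The high-frequency part of the amplitude is small in `L¹`. -/
theorem integrableOn_Ioi_and_integral_le {s : ℝ} (hs : 0 < s) :
    IntegrableOn g (Ioi s) ∧ ∫ η in Ioi s, ‖g η‖ ≤ s⁻¹ := by
  have hc := hg.contDiff.continuous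
  have hsub : Ioi s ⊆ Ioi 0 := Ioi_subset_Ioi hs.le
  have hi := hg.integrable.mono_set hsub
  have hr : IntegrableOn (fun η : ℝ => η ^ (-3 : ℝ)) (Ioi s) :=
    integrableOn_Ioi_rpow_of_lt (by norm_num) hs
  have hbi := (hi.const_mul (s⁻¹ / 2)).add (hr.const_mul (s / 2))
  have hpt : ∀ x ∈ Ioi s, ‖g x‖ ≤ s⁻¹ / 2 * energyDensity g x + s / 2 * x ^ (-3 : ℝ) := by
    intro x hx
    have hx0 : 0 < x := hs.trans hx
    rw [show x ^ (-3 : ℝ) = (x ^ 3)⁻¹ by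
      rw [Real.rpow_neg hx0.le]; norm_cast]
    -- AM-GM again, now pairing the `η³` weight with the integrable tail `η⁻³`.
    have h1 : s⁻¹ / 2 * (‖g x‖ ^ 2 * x ^ 3) + s / 2 * (x ^ 3)⁻¹ - ‖g x‖ =
        (‖g x‖ * x ^ 3 - s) ^ 2 / (2 * s * x ^ 3) := by field_simp; ring
    have h2 : 0 ≤ (‖g x‖ * x ^ 3 - s) ^ 2 / (2 * s * x ^ 3) := by positivity
    have h3 : 0 ≤ s⁻¹ / 2 * (‖g x‖ ^ 2 / x) := by positivity
    have h4 : 0 ≤ s⁻¹ / 2 * (x * ‖deriv g x‖ ^ 2) := by positivity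
    unfold energyDensity
    linarith
  have hgi : IntegrableOn g (Ioi s) := hbi.mono' hc.aestronglyMeasurable
    ((ae_restrict_iff' measurableSet_Ioi).2 (.of_forall hpt))
  refine ⟨hgi, (setIntegral_mono_on hgi.norm hbi measurableSet_Ioi hpt).trans ?_⟩
  simp only [Pi.add_apply]
  rw [integral_add (hi.const_mul _) (hr.const_mul _), integral_const_mul, integral_const_mul,
    integral_Ioi_rpow_of_lt (by norm_num) hs]
  have h2 : s⁻¹ / 2 * ∫ η in Ioi s, energyDensity g η ≤ s⁻¹ / 2 * 1 := by
    gcongr; exact hg.setIntegral_le_one hsub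
  have h3 : s / 2 * (-s ^ ((-3 : ℝ) + 1) / (-3 + 1)) = s⁻¹ / 4 := by
    rw [show (-3 : ℝ) + 1 = -2 by norm_num, Real.rpow_neg hs.le]
    norm_cast
    push_cast
    field_simp; norm_num
  have : 0 < s⁻¹ := by positivity
  linarith

end UnitEnergy

/-! ### Oscillatory integrals with quadratic phase -/

/-- The oscillatory factor with quadratic phase `x (η² - 2 c η)`, stationary at `η = c`. -/
def chirp (x c η : ℝ) : ℂ := Complex.exp (Complex.I * (x * (η ^ 2 - 2 * c * η) : ℝ))

theorem norm_chirp (x c η : ℝ) : ‖chirp x c η‖ = 1 := by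
  rw [chirp, mul_comm, Complex.norm_exp_ofReal_mul_I]

theorem continuous_chirp (x c : ℝ) : Continuous (chirp x c) := by
  unfold chirp; fun_prop

theorem hasDerivAt_chirp (x c η : ℝ) :
    HasDerivAt (chirp x c) (chirp x c η * (Complex.I * (2 * x * (η - c) : ℝ))) η := by
  have h : HasDerivAt (fun η : ℝ => x * (η ^ 2 - 2 * c * η)) (2 * x * (η - c)) η := by
    refine (((hasDerivAt_pow 2 η).fun_sub ((hasDerivAt_id' η).const_mul (2 * c))).const_mul
      x).congr_deriv ?_
    simp only [Nat.cast_ofNat, Nat.add_one_sub_one, pow_one, mul_one]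
    ring
  exact (h.ofReal_comp.const_mul Complex.I).cexp

theorem integral_inv_sub_sq_le {p q c s : ℝ} (hs : 0 < s) (hpq : p ≤ q)
    (h : c + s⁻¹ ≤ p ∨ q ≤ c - s⁻¹) :
    IntervalIntegrable (fun η => ((η - c) ^ 2)⁻¹) volume p q ∧
      ∫ η in p..q, ((η - c) ^ 2)⁻¹ ≤ s := by
  have hs' : 0 < s⁻¹ := by positivity
  have hne : ∀ η ∈ uIcc p q, η - c ≠ 0 := by
    intro η hη
    rw [uIcc_of_le hpq] at hη
    rcases h with h | h
    · have := hη.1; exact (by linarith : 0 < η - c).ne'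
    · have := hη.2; exact (by linarith : η - c < 0).ne
  have hi : IntervalIntegrable (fun η => ((η - c) ^ 2)⁻¹) volume p q :=
    ContinuousOn.intervalIntegrable (ContinuousOn.inv₀ (by fun_prop)
      fun η hη => pow_ne_zero 2 (hne η hη))
  refine ⟨hi, ?_⟩
  have hd : ∀ η ∈ uIcc p q, HasDerivAt (fun η => -(η - c)⁻¹) (((η - c) ^ 2)⁻¹) η := fun η hη => by
    refine (((hasDerivAt_id' η).sub_const c).fun_inv (hne η hη)).fun_neg.congr_deriv ?_
    simp [neg_div]
  rw [intervalIntegral.integral_eq_sub_of_hasDerivAt hd hi]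
  rcases h with h | h
  · have h1 : (p - c)⁻¹ ≤ s := inv_le_of_inv_le₀ hs (by linarith)
    have h2 : 0 ≤ (q - c)⁻¹ := inv_nonneg.2 (by linarith)
    linarith
  · have h1 : (c - q)⁻¹ ≤ s := inv_le_of_inv_le₀ hs (by linarith)
    have h2 : 0 ≤ (c - p)⁻¹ := inv_nonneg.2 (by linarith)
    rw [show q - c = -(c - q) by ring, show p - c = -(c - p) by ring, inv_neg, inv_neg]
    linarith

/-- Integration by parts at distance at least `1/s` from the stationary point: each boundary term
costs `3/s` and the remaining integral `5/s`. -/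
theorem UnitEnergy.norm_integral_chirp_mul_le_of_nonstationary {g : ℝ → ℂ} (hg : UnitEnergy g)
    {x c s p q : ℝ} (hs : 1 ≤ s) (hx : x ≠ 0) (hxc : |2 * x| * |c| = s ^ 2) (hp : s⁻¹ ≤ p)
    (hpq : p ≤ q) (hq : q ≤ s) (h : c + s⁻¹ ≤ p ∨ q ≤ c - s⁻¹) :
    ‖∫ η in p..q, chirp x c η * g η‖ ≤ 11 * s⁻¹ := by
  have hs0 : 0 < s := by linarith
  have hs' : 0 < s⁻¹ := by positivity
  have hp0 : 0 < p := by linarith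
  have hdist : ∀ η ∈ Icc p q, s⁻¹ ≤ |η - c| := by
    intro η hη
    rcases h with h | h
    · exact le_abs.2 (.inl (by linarith [hη.1]))
    · exact le_abs.2 (.inr (by linarith [hη.2]))
  have hne : ∀ η ∈ Icc p q, η - c ≠ 0 := fun η hη =>
    abs_pos.1 (hs'.trans_le (hdist η hη))
  -- Trading `1/|2x|` for `|c|/s²` removes `x` from all later bounds; `|c| ≤ |η - c| + η` then
  -- removes `c` outside `|η - c|`.
  have hinvx : |2 * x|⁻¹ = |c| / s ^ 2 := by
    rw [← hxc, div_mul_cancel_right₀]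
    rintro h0
    rw [h0, mul_zero] at hxc
    have : 0 < s ^ 2 := by positivity
    linarith
  have hc1 : ∀ η ∈ Icc p q, |c| ≤ |η - c| + η := fun η hη => by
    have := abs_sub_abs_le_abs_sub c η
    rw [abs_of_pos (hp0.trans_le hη.1), abs_sub_comm] at this
    linarith
  have hr : ∀ η ∈ Icc p q, |(2 * x * (η - c))⁻¹| ≤ (1 + η / |η - c|) / s ^ 2 := fun η hη => by
    have hd : 0 < |η - c| := hs'.trans_le (hdist η hη)
    rw [abs_inv, abs_mul, mul_inv, hinvx]
    have : (1 + η / |η - c|) / s ^ 2 = (|η - c| + η) / s ^ 2 * |η - c|⁻¹ := by field_simp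
    rw [this]
    gcongr
    exact hc1 η hη
  have hd : ∀ η ∈ uIcc p q, HasDerivAt (fun η => -Complex.I * (((2 * x * (η - c))⁻¹ : ℝ) : ℂ) * g η)
      (-Complex.I * ((-(2 * x * (η - c) ^ 2)⁻¹ : ℝ) : ℂ) * g η +
        -Complex.I * (((2 * x * (η - c))⁻¹ : ℝ) : ℂ) * deriv g η) η := by
    intro η hη
    rw [uIcc_of_le hpq] at hη
    have hη' := hne η hη
    have h1 : HasDerivAt (fun η : ℝ => (2 * x * (η - c))⁻¹) (-(2 * x * (η - c) ^ 2)⁻¹) η := by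
      refine ((((hasDerivAt_id' η).sub_const c).const_mul (2 * x)).fun_inv
        (by simpa using ⟨hx, hη'⟩)).congr_deriv ?_
      field_simp
    exact (h1.ofReal_comp.const_mul (-Complex.I)).fun_mul (hg.hasDerivAt η)
  have hgc := hg.contDiff.continuous
  have hgc' := hg.continuous_deriv
  have hcc := continuous_chirp x c
  have hcr : ContinuousOn (fun η : ℝ => (2 * x * (η - c))⁻¹) (uIcc p q) := by
    rw [uIcc_of_le hpq]
    exact ContinuousOn.inv₀ (by fun_prop) fun η hη => mul_ne_zero (by positivity) (hne η hη)
  have hcr2 : ContinuousOn (fun η : ℝ => (2 * x * (η - c) ^ 2)⁻¹) (uIcc p q) := by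
    rw [uIcc_of_le hpq]
    exact ContinuousOn.inv₀ (by fun_prop) fun η hη =>
      mul_ne_zero (by positivity) (pow_ne_zero 2 (hne η hη))
  have hIBP := intervalIntegral.integral_mul_deriv_eq_deriv_mul hd
    (fun η _ => hasDerivAt_chirp x c η)
    (ContinuousOn.intervalIntegrable (by fun_prop)) (Continuous.intervalIntegrable (by fun_prop) _ _)
  have hcongr : ∫ η in p..q, chirp x c η * g η = ∫ η in p..q,
      (-Complex.I * (((2 * x * (η - c))⁻¹ : ℝ) : ℂ) * g η) *
        (chirp x c η * (Complex.I * (2 * x * (η - c) : ℝ))) := by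
    refine intervalIntegral.integral_congr fun η hη => ?_
    rw [uIcc_of_le hpq] at hη
    have h1 : (((2 * x * (η - c))⁻¹ : ℝ) : ℂ) * ((2 * x * (η - c) : ℝ) : ℂ) = 1 := by
      rw [← Complex.ofReal_mul, inv_mul_cancel₀ (mul_ne_zero (by positivity) (hne η hη)),
        Complex.ofReal_one]
    linear_combination (exp := 1) (-(chirp x c η * g η)) * h1 +
      (chirp x c η * g η * (((2 * x * (η - c))⁻¹ : ℝ) : ℂ) * ((2 * x * (η - c) : ℝ) : ℂ)) *
        Complex.I_mul_I
  have hbd : ∀ η ∈ Icc p q,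
      ‖-Complex.I * (((2 * x * (η - c))⁻¹ : ℝ) : ℂ) * g η * chirp x c η‖ ≤ 3 * s⁻¹ := by
    intro η hη
    have hη0 : 0 ≤ η := hp0.le.trans hη.1
    have hd : 0 < |η - c| := hs'.trans_le (hdist η hη)
    rw [norm_mul, norm_chirp, mul_one, norm_mul, norm_mul, norm_neg, Complex.norm_I, one_mul,
      Complex.norm_real, Real.norm_eq_abs]
    have h1 := hr η hη
    have h2 : |η - c|⁻¹ ≤ s := inv_le_of_inv_le₀ hs0 (hdist η hη)
    have h3 := hg.mul_norm_le_two hη0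
    have h4 := hg.norm_le_one hη0
    calc |(2 * x * (η - c))⁻¹| * ‖g η‖ ≤ (1 + η / |η - c|) / s ^ 2 * ‖g η‖ := by gcongr
      _ = (‖g η‖ + η * ‖g η‖ * |η - c|⁻¹) / s ^ 2 := by field_simp
      _ ≤ (1 * s + 2 * s) / s ^ 2 := by gcongr; nlinarith
      _ = 3 * s⁻¹ := by field_simp; ring
  obtain ⟨hdi, hdle⟩ := integral_inv_sub_sq_le hs0 hpq h
  have hen := hg.intervalIntegrable hp0.le hpq
  have hbulk : ‖∫ η in p..q, (-Complex.I * ((-(2 * x * (η - c) ^ 2)⁻¹ : ℝ) : ℂ) * g η +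
        -Complex.I * (((2 * x * (η - c))⁻¹ : ℝ) : ℂ) * deriv g η) * chirp x c η‖ ≤ 5 * s⁻¹ := by
    -- The integral of this majorant is at most `s + s + 3s`, using unit energy, `q - p ≤ s`, and `∫
    -- (η - c)⁻² ≤ s`.
    have hi1 : IntervalIntegrable (fun η => s * energyDensity g η + 1 + 3 * ((η - c) ^ 2)⁻¹)
      volume p q := ((hen.const_mul s).add intervalIntegrable_const).add (hdi.const_mul 3)
    refine (intervalIntegral.norm_integral_le_of_norm_le hpq (.of_forall fun η hη => ?_)
      (hi1.const_mul (s ^ 2)⁻¹)).trans ?_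
    · replace hη : η ∈ Icc p q := ⟨hη.1.le, hη.2⟩
      have hη0 : 0 < η := hp0.trans_le hη.1
      have hd : 0 < |η - c| := hs'.trans_le (hdist η hη)
      rw [norm_mul, norm_chirp, mul_one]
      refine (norm_add_le _ _).trans ?_
      simp only [norm_mul, norm_neg, Complex.norm_I, one_mul, Complex.norm_real, Real.norm_eq_abs,
        Complex.ofReal_neg]
      have e1 : |(2 * x * (η - c) ^ 2)⁻¹| = |(2 * x * (η - c))⁻¹| * |η - c|⁻¹ := by
        rw [← abs_inv, ← abs_mul]; congr 1; field_simp
      have e2 : ((η - c) ^ 2)⁻¹ = |η - c|⁻¹ ^ 2 := by rw [inv_pow, sq_abs]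
      rw [e1, e2]
      have h1 := hr η hη
      rw [div_eq_mul_inv, div_eq_mul_inv η] at h1
      set d := |η - c|⁻¹
      have hd0 : 0 < d := by positivity
      have h3 := hg.mul_norm_le_two hη0.le
      have h4 := hg.norm_le_one hη0.le
      have h5 : s⁻¹ * η⁻¹ ≤ 1 := by
        rw [← mul_inv]
        refine inv_le_one_of_one_le₀ ?_
        calc 1 = s * s⁻¹ := by field_simp
          _ ≤ s * η := by gcongr; exact hp.trans hη.1
      have h6 : s⁻¹ * η ≤ 1 := by
        rw [inv_mul_le_iff₀ hs0, mul_one]; exact hη.2.trans hq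
      -- Weighted AM-GM, used with `y = 1` and `y = η d`. The errors are controlled by `1/(sη) ≤ 1`
      -- and `η/s ≤ 1`, which is where the cutoffs `1/s` and `s` enter.
      have hD : ∀ y, ‖deriv g η‖ * y ≤ s / 2 * (η * ‖deriv g η‖ ^ 2) + s⁻¹ * η⁻¹ / 2 * y ^ 2 := by
        intro y
        have : s / 2 * (η * ‖deriv g η‖ ^ 2) + s⁻¹ * η⁻¹ / 2 * y ^ 2 - ‖deriv g η‖ * y =
          (s * η * ‖deriv g η‖ - y) ^ 2 / (2 * s * η) := by field_simp; ring
        have h' : 0 ≤ (s * η * ‖deriv g η‖ - y) ^ 2 / (2 * s * η) := by positivity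
        linarith
      have hE : η * ‖deriv g η‖ ^ 2 ≤ energyDensity g η := by
        have : 0 ≤ ‖g η‖ ^ 2 / η := by positivity
        have : 0 ≤ ‖g η‖ ^ 2 * η ^ 3 := by positivity
        unfold energyDensity; linarith
      have t1 := hD 1
      have t2 := hD (η * d)
      have t3 : s⁻¹ * η⁻¹ / 2 * (η * d) ^ 2 ≤ d ^ 2 / 2 := by
        calc s⁻¹ * η⁻¹ / 2 * (η * d) ^ 2 = (s⁻¹ * η) * (d ^ 2 / 2) := by field_simp
          _ ≤ 1 * (d ^ 2 / 2) := by gcongr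
          _ = d ^ 2 / 2 := one_mul _
      have t4 : s * (η * ‖deriv g η‖ ^ 2) ≤ s * energyDensity g η := by gcongr
      have t5 : ‖g η‖ * d ≤ 1 / 2 + d ^ 2 / 2 := by
        have : ‖g η‖ * d ≤ 1 * d := by gcongr
        nlinarith [sq_nonneg (d - 1)]
      have t6 : η * ‖g η‖ * d ^ 2 ≤ 2 * d ^ 2 := by gcongr
      have key : ‖g η‖ * d + η * ‖g η‖ * d ^ 2 + ‖deriv g η‖ * 1 + ‖deriv g η‖ * (η * d) ≤
          s * energyDensity g η + 1 + 3 * d ^ 2 := by linarith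
      calc |(2 * x * (η - c))⁻¹| * d * ‖g η‖ + |(2 * x * (η - c))⁻¹| * ‖deriv g η‖
          = |(2 * x * (η - c))⁻¹| * (d * ‖g η‖ + ‖deriv g η‖) := by ring
        _ ≤ ((1 + η * d) * (s ^ 2)⁻¹) * (d * ‖g η‖ + ‖deriv g η‖) := by
          gcongr
        _ = (s ^ 2)⁻¹ * (‖g η‖ * d + η * ‖g η‖ * d ^ 2 + ‖deriv g η‖ * 1
              + ‖deriv g η‖ * (η * d)) := by ring
        _ ≤ (s ^ 2)⁻¹ * (s * energyDensity g η + 1 + 3 * d ^ 2) := by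
          gcongr
    · rw [intervalIntegral.integral_const_mul, intervalIntegral.integral_add
        ((hen.const_mul s).add intervalIntegrable_const) (hdi.const_mul 3),
        intervalIntegral.integral_add (hen.const_mul s) intervalIntegrable_const,
        intervalIntegral.integral_const_mul, intervalIntegral.integral_const_mul,
        intervalIntegral.integral_const, smul_eq_mul, mul_one]
      have t1 : s * ∫ η in p..q, energyDensity g η ≤ s * 1 := by
        gcongr; exact hg.intervalIntegral_le_one hp0.le hpq
      calc _ ≤ (s ^ 2)⁻¹ * (5 * s) := by gcongr; linarith
        _ = 5 * s⁻¹ := by field_simp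
  rw [hcongr, hIBP]
  have b1 := hbd q ⟨hpq, le_rfl⟩
  have b2 := hbd p ⟨le_rfl, hpq⟩
  refine (norm_sub_le _ _).trans ?_
  refine (add_le_add (norm_sub_le _ _) hbulk).trans ?_
  linarith

theorem UnitEnergy.integrableOn {g : ℝ → ℂ} (hg : UnitEnergy g) : IntegrableOn g (Ioi 0) := by
  have h := (hg.integrableOn_Ioi_and_integral_le one_pos).1
  have := (hg.contDiff.continuous.integrableOn_Ioc (a := 0) (b := 1) (μ := volume)).union h
  rwa [Ioc_union_Ioi_eq_Ioi zero_le_one] at this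

theorem UnitEnergy.integral_norm_le_two {g : ℝ → ℂ} (hg : UnitEnergy g) :
    ∫ η in Ioi 0, ‖g η‖ ≤ 2 := by
  have h1 := hg.integral_norm_le_inv one_pos
  have h2 := hg.integrableOn_Ioi_and_integral_le one_pos
  rw [inv_one] at h1
  rw [← intervalIntegral.integral_interval_add_Ioi hg.integrableOn.norm h2.1.norm]
  linarith [h2.2]

/-- The constant is `26 = 1 + 1 + 2 + 11 + 11`: low frequencies, high frequencies, the stationary
window, and the nonstationary pieces on either side of it. -/
theorem UnitEnergy.norm_integral_chirp_mul_le {g : ℝ → ℂ} (hg : UnitEnergy g)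
    {x c s : ℝ} (hs : 1 ≤ s) (hx : x ≠ 0) (hxc : |2 * x| * |c| = s ^ 2) :
    ‖∫ η in Ioi 0, chirp x c η * g η‖ ≤ 26 * s⁻¹ := by
  have hs0 : 0 < s := by linarith
  have hs' : 0 < s⁻¹ := by positivity
  have hss : s⁻¹ ≤ s := (inv_le_one_of_one_le₀ hs).trans hs
  have hgc := hg.contDiff.continuous
  have hcc := continuous_chirp x c
  have hnorm : ∀ η, ‖chirp x c η * g η‖ = ‖g η‖ := fun η => by
    rw [norm_mul, norm_chirp, one_mul]
  have hI : ∀ {S : Set ℝ}, IntegrableOn g S → IntegrableOn (fun η => chirp x c η * g η) S :=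
    fun h => Integrable.mono h (hcc.mul hgc).aestronglyMeasurable
      (.of_forall fun η => (hnorm η).le)
  have hii : ∀ a b, IntervalIntegrable (fun η => chirp x c η * g η) volume a b := fun a b =>
    Continuous.intervalIntegrable (by fun_prop) _ _
  obtain ⟨hhi, hhle⟩ := hg.integrableOn_Ioi_and_integral_le hs0
  -- Clamping `c ± s⁻¹` to `[s⁻¹, s]` treats every position of `c` at once; some pieces may
  -- degenerate to a point.
  set p := max s⁻¹ (min (c - s⁻¹) s) with hp
  set q := max s⁻¹ (min (c + s⁻¹) s) with hq
  have hp1 : s⁻¹ ≤ p := le_max_left _ _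
  have hps : p ≤ s := max_le hss (min_le_right _ _)
  have hq1 : s⁻¹ ≤ q := le_max_left _ _
  have hqs : q ≤ s := max_le hss (min_le_right _ _)
  have hpq : p ≤ q := max_le_max le_rfl (min_le_min (by linarith) le_rfl)
  rw [← intervalIntegral.integral_interval_add_Ioi (hI hg.integrableOn) (hI hhi),
    ← intervalIntegral.integral_add_adjacent_intervals (hii 0 s⁻¹) (hii s⁻¹ s),
    ← intervalIntegral.integral_add_adjacent_intervals (hii s⁻¹ p) (hii p s),
    ← intervalIntegral.integral_add_adjacent_intervals (hii p q) (hii q s)]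
  have b1 : ‖∫ η in (0)..s⁻¹, chirp x c η * g η‖ ≤ s⁻¹ := by
    refine (intervalIntegral.norm_integral_le_integral_norm hs'.le).trans ?_
    simp only [hnorm]
    exact hg.integral_norm_le_inv hs0
  have b2 : ‖∫ η in Ioi s, chirp x c η * g η‖ ≤ s⁻¹ := by
    refine (norm_integral_le_integral_norm _).trans ?_
    simp only [hnorm]
    exact hhle
  have b3 : ‖∫ η in p..q, chirp x c η * g η‖ ≤ 2 * s⁻¹ := by
    have := intervalIntegral.norm_integral_le_of_norm_le_const (a := p) (b := q) (C := 1)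
      (f := fun η => chirp x c η * g η) fun η hη => by
        rw [uIoc_of_le hpq] at hη
        rw [hnorm]
        exact hg.norm_le_one (by linarith [hη.1])
    rw [one_mul, abs_of_nonneg (by linarith)] at this
    refine this.trans ?_
    have : q ≤ p + 2 * s⁻¹ := by
      refine max_le (by linarith) ?_
      have h1 : min (c - s⁻¹) s ≤ p := le_max_right _ _
      rcases le_total (c - s⁻¹) s with h | h
      · rw [min_eq_left h] at h1
        exact (min_le_left _ _).trans (by linarith)
      · rw [min_eq_right h] at h1
        exact (min_le_right _ _).trans (by linarith)
    linarith
  have b4 : ‖∫ η in s⁻¹..p, chirp x c η * g η‖ ≤ 11 * s⁻¹ := by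
    rcases eq_or_lt_of_le hp1 with h | h
    · rw [← h, intervalIntegral.integral_same, norm_zero]; positivity
    · refine hg.norm_integral_chirp_mul_le_of_nonstationary hs hx hxc le_rfl hp1 hps (.inr ?_)
      rw [hp, lt_max_iff] at h
      rcases h with h | h
      · exact absurd h (lt_irrefl _)
      · rw [hp, max_eq_right h.le]; exact min_le_left _ _
  have b5 : ‖∫ η in q..s, chirp x c η * g η‖ ≤ 11 * s⁻¹ := by
    rcases eq_or_lt_of_le hqs with h | h
    · rw [h, intervalIntegral.integral_same, norm_zero]; positivity
    · refine hg.norm_integral_chirp_mul_le_of_nonstationary hs hx hxc hq1 hqs le_rfl (.inl ?_)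
      have h1 : min (c + s⁻¹) s ≤ q := le_max_right _ _
      rcases le_total (c + s⁻¹) s with h' | h'
      · rwa [min_eq_left h'] at h1
      · rw [min_eq_right h'] at h1; linarith
  refine (norm_add_le _ _).trans ?_
  refine (add_le_add_left (norm_add_le _ _) _).trans ?_
  have := norm_add_le (∫ η in s⁻¹..p, chirp x c η * g η)
    ((∫ η in p..q, chirp x c η * g η) + ∫ η in q..s, chirp x c η * g η)
  have := norm_add_le (∫ η in p..q, chirp x c η * g η) (∫ η in q..s, chirp x c η * g η)
  linarith

/-! ### The substitution `w = η²` and the half-line estimate -/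

theorem inv_sqrt_le_two_mul_one_add_rpow {r : ℝ} (hr : 1 ≤ r) :
    (√r)⁻¹ ≤ 2 * (1 + r) ^ (-(1 / 2) : ℝ) := by
  have hr0 : 0 < r := by linarith
  rw [Real.rpow_neg (by linarith), ← Real.sqrt_eq_rpow, ← div_eq_mul_inv, inv_eq_one_div,
    div_le_div_iff₀ (by positivity) (by positivity), one_mul]
  calc √(1 + r) ≤ √(2 ^ 2 * r) := Real.sqrt_le_sqrt (by linarith)
    _ = 2 * √r := by rw [Real.sqrt_mul (by norm_num), Real.sqrt_sq (by norm_num)]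

/-- The weighted density `|F|² + |w F|² + |w F'|²` on the frequency side. -/
def frequencyDensity (F : ℝ → ℂ) (w : ℝ) : ℝ :=
  ‖F w‖ ^ 2 + ‖w * F w‖ ^ 2 + ‖w * deriv F w‖ ^ 2

theorem frequencyDensity_nonneg (F : ℝ → ℂ) (w : ℝ) : 0 ≤ frequencyDensity F w := by
  unfold frequencyDensity; positivity

theorem integral_Ioi_comp_sq {E : Type*} [NormedAddCommGroup E] [NormedSpace ℝ E] (G : ℝ → E) :
    ∫ η in Ioi (0 : ℝ), (2 * η) • G (η ^ 2) = ∫ w in Ioi 0, G w := by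
  rw [← integral_comp_rpow_Ioi_of_pos (g := G) two_pos]
  refine setIntegral_congr_fun measurableSet_Ioi fun η _ => ?_
  simp only [Real.rpow_two]
  norm_num

theorem integrableOn_Ioi_comp_sq {E : Type*} [NormedAddCommGroup E] [NormedSpace ℝ E]
    {G : ℝ → E} (hG : IntegrableOn G (Ioi 0)) :
    IntegrableOn (fun η : ℝ => (2 * η) • G (η ^ 2)) (Ioi 0) := by
  refine ((integrableOn_Ioi_comp_rpow_iff G (two_ne_zero)).2 hG).congr_fun (fun η _ => ?_)
    measurableSet_Ioi
  simp only [Real.rpow_two]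
  norm_num

/-- After `w = η²` each energy term is dominated by a term of `2η · frequencyDensity F (η²)`, up to
a cross term from the product rule in `g'`. -/
theorem unitEnergy_of_frequencyDensity {F : ℝ → ℂ} (hF : ContDiff ℝ 1 F)
    (hi : IntegrableOn (frequencyDensity F) (Ioi 0)) {M : ℝ} (hM : 0 < M)
    (hle : ∫ w in Ioi 0, frequencyDensity F w ≤ M ^ 2) :
    UnitEnergy fun η => ((η / (2 * M) : ℝ) : ℂ) * F (η ^ 2) := by
  set g : ℝ → ℂ := fun η => ((η / (2 * M) : ℝ) : ℂ) * F (η ^ 2) with hg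
  have hgd : ContDiff ℝ 1 g := by
    have h1 : ContDiff ℝ 1 fun η : ℝ => ((η / (2 * M) : ℝ) : ℂ) :=
      Complex.ofRealCLM.contDiff.comp (contDiff_id.div_const _)
    exact h1.mul (hF.comp (contDiff_id.pow 2))
  have hderiv : ∀ η, deriv g η = ((1 / (2 * M) : ℝ) : ℂ) * F (η ^ 2) +
      ((η / (2 * M) : ℝ) : ℂ) * (((2 * η : ℝ) : ℂ) * deriv F (η ^ 2)) := by
    intro η
    have h1 : HasDerivAt (fun η : ℝ => ((η / (2 * M) : ℝ) : ℂ)) ((1 / (2 * M) : ℝ) : ℂ) η :=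
      ((hasDerivAt_id' η).div_const _).ofReal_comp
    have h2 : HasDerivAt (fun η : ℝ => η ^ 2) (2 * η) η := by simpa using hasDerivAt_pow 2 η
    have h3 := ((hF.differentiable (by norm_num) (η ^ 2)).hasDerivAt).scomp η h2
    have h4 := (h1.fun_mul h3).deriv
    simpa [hg, Function.comp_def] using h4
  have hpt : ∀ η ∈ Ioi (0 : ℝ), energyDensity g η ≤
      (M ^ 2)⁻¹ * ((2 * η) • frequencyDensity F (η ^ 2)) := by
    intro η hη
    have hη0 : 0 < η := hη
    have n1 : ‖g η‖ = η / (2 * M) * ‖F (η ^ 2)‖ := by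
      rw [hg, norm_mul, Complex.norm_real, Real.norm_of_nonneg (by positivity)]
    have n2 : ‖deriv g η‖ ≤ 1 / (2 * M) * ‖F (η ^ 2)‖ +
        η / (2 * M) * (2 * η * ‖deriv F (η ^ 2)‖) := by
      rw [hderiv]
      refine (norm_add_le _ _).trans_eq ?_
      rw [norm_mul, norm_mul, norm_mul, Complex.norm_real, Complex.norm_real, Complex.norm_real,
        Real.norm_of_nonneg (by positivity), Real.norm_of_nonneg (by positivity),
        Real.norm_of_nonneg (by positivity)]
    have n3 : ‖deriv g η‖ ^ 2 ≤ (1 / (2 * M) * ‖F (η ^ 2)‖ +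
        η / (2 * M) * (2 * η * ‖deriv F (η ^ 2)‖)) ^ 2 := by gcongr
    have n4 : η * ‖deriv g η‖ ^ 2 ≤ η * (1 / (2 * M) * ‖F (η ^ 2)‖ +
        η / (2 * M) * (2 * η * ‖deriv F (η ^ 2)‖)) ^ 2 := by gcongr
    unfold energyDensity frequencyDensity
    rw [n1, norm_mul, norm_mul, Complex.norm_real, Real.norm_of_nonneg (by positivity), smul_eq_mul]
    set u := ‖F (η ^ 2)‖
    set v := ‖deriv F (η ^ 2)‖
    -- The difference is a sum of squares; with the normalisation `2M` the `v²` contributions cancel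
    -- apart from the completed square.
    have e : (M ^ 2)⁻¹ * (2 * η * (u ^ 2 + (η ^ 2 * u) ^ 2 + (η ^ 2 * v) ^ 2)) -
        ((η / (2 * M) * u) ^ 2 / η + (η / (2 * M) * u) ^ 2 * η ^ 3 +
          η * (1 / (2 * M) * u + η / (2 * M) * (2 * η * v)) ^ 2) =
        (M ^ 2)⁻¹ * η * ((5 / 4) * u ^ 2 + 7 / 4 * (η ^ 2 * u) ^ 2 +
          1 / 4 * (u - 2 * (η ^ 2 * v)) ^ 2) := by
      field_simp
      ring
    have : 0 ≤ (M ^ 2)⁻¹ * η * ((5 / 4) * u ^ 2 + 7 / 4 * (η ^ 2 * u) ^ 2 +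
          1 / 4 * (u - 2 * (η ^ 2 * v)) ^ 2) := by positivity
    linarith
  have hbi := (integrableOn_Ioi_comp_sq hi).const_mul (M ^ 2)⁻¹
  have hgc := hgd.continuous
  have hgc' : Continuous (deriv g) := hgd.continuous_deriv (by norm_num)
  have hmeas : AEStronglyMeasurable (energyDensity g) (volume.restrict (Ioi 0)) := by
    have : Measurable (energyDensity g) := by
      unfold energyDensity
      have := hgc.measurable
      have := hgc'.measurable
      fun_prop
    exact this.aestronglyMeasurable
  have hint : IntegrableOn (energyDensity g) (Ioi 0) := by
    refine hbi.mono' hmeas ((ae_restrict_iff' measurableSet_Ioi).2 (.of_forall fun η hη => ?_))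
    rw [Real.norm_of_nonneg (energyDensity_nonneg g (mem_Ioi.1 hη).le)]
    exact hpt η hη
  refine ⟨hgd, by simp [hg], hint, ?_⟩
  refine (setIntegral_mono_on hint hbi measurableSet_Ioi hpt).trans ?_
  rw [integral_const_mul, integral_Ioi_comp_sq, inv_mul_le_iff₀ (by positivity), mul_one]
  exact hle

/-- Completing the square puts the stationary point at `c = -τ/(2X)`, so `|2X||c| = |τ|` and `s =
√|τ|` is admissible when `|τ| ≥ 1`. The constant is `208 = 4 · 26 · 2`, with `4M` from the Jacobian
and normalisation and `2` from replacing `|τ|` by `1 + |τ|`. -/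
theorem norm_integral_Ioi_le {F G : ℝ → ℂ} (hF : ContDiff ℝ 1 F)
    (hi : IntegrableOn (frequencyDensity F) (Ioi 0)) {M : ℝ} (hM : 0 < M)
    (hle : ∫ w in Ioi 0, frequencyDensity F w ≤ M ^ 2) {X τ : ℝ} (hX : X ≠ 0)
    (hG : ∀ η : ℝ, 0 < η → G (η ^ 2) =
      Complex.exp (Complex.I * (X * η ^ 2 + τ * η : ℝ)) * F (η ^ 2)) :
    ‖∫ w in Ioi 0, G w‖ ≤ 208 * M * (1 + |τ|) ^ (-(1 / 2) : ℝ) := by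
  have hg := unitEnergy_of_frequencyDensity hF hi hM hle
  set g : ℝ → ℂ := fun η => ((η / (2 * M) : ℝ) : ℂ) * F (η ^ 2) with hgdef
  set c := -τ / (2 * X) with hc
  have heq : ∫ w in Ioi 0, G w = ((4 * M : ℝ) : ℂ) * ∫ η in Ioi 0, chirp X c η * g η := by
    rw [← integral_Ioi_comp_sq, ← integral_const_mul]
    refine setIntegral_congr_fun measurableSet_Ioi fun η hη => ?_
    have hphase : X * η ^ 2 + τ * η = X * (η ^ 2 - 2 * c * η) := by
      rw [hc]; field_simp; ring
    have hM' : (M : ℂ) ≠ 0 := Complex.ofReal_ne_zero.2 hM.ne'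
    simp only [hG η hη, hphase, chirp, hgdef, Complex.real_smul]
    push_cast
    field_simp
    ring
  rw [heq, norm_mul, Complex.norm_real, Real.norm_of_nonneg (by positivity)]
  have hmain : ‖∫ η in Ioi 0, chirp X c η * g η‖ ≤ 52 * (1 + |τ|) ^ (-(1 / 2) : ℝ) := by
    rcases le_total 1 |τ| with h | h
    · have hs : 1 ≤ √|τ| := Real.one_le_sqrt.2 h
      have hxc : |2 * X| * |c| = √|τ| ^ 2 := by
        rw [Real.sq_sqrt (abs_nonneg _), ← abs_mul, hc, mul_div_cancel₀ _ (by positivity), abs_neg]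
      have h1 := hg.norm_integral_chirp_mul_le hs hX hxc
      have h2 := inv_sqrt_le_two_mul_one_add_rpow h
      linarith
    · have h1 : ‖∫ η in Ioi 0, chirp X c η * g η‖ ≤ 2 := by
        refine (norm_integral_le_integral_norm _).trans ?_
        simp only [norm_mul, norm_chirp, one_mul]
        simpa only [norm_mul] using hg.integral_norm_le_two
      have h2 := inv_sqrt_le_two_mul_one_add_rpow le_rfl
      have h3 : (1 + 1 : ℝ) ^ (-(1 / 2) : ℝ) ≤ (1 + |τ|) ^ (-(1 / 2) : ℝ) :=
        Real.rpow_le_rpow_of_nonpos (by positivity) (by linarith) (by norm_num)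
      rw [Real.sqrt_one, inv_one] at h2
      linarith
  calc 4 * M * ‖∫ η in Ioi 0, chirp X c η * g η‖
      ≤ 4 * M * (52 * (1 + |τ|) ^ (-(1 / 2) : ℝ)) := by gcongr
    _ = _ := by ring

/-! ### Plancherel bounds on the frequency side -/

/-- The Schwartz function `x ∂ₓφ`. -/
def mulDeriv (φ : 𝓢(ℝ, ℂ)) : 𝓢(ℝ, ℂ) :=
  SchwartzMap.smulLeftCLM ℂ (fun x : ℝ => x) (SchwartzMap.derivCLM ℂ ℂ φ)

theorem mulDeriv_apply (φ : 𝓢(ℝ, ℂ)) (x : ℝ) : mulDeriv φ x = x * deriv φ x := by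
  have : (fun x : ℝ => x).HasTemperateGrowth := by fun_prop
  rw [mulDeriv, SchwartzMap.smulLeftCLM_apply_apply this, SchwartzMap.derivCLM_apply,
    Complex.real_smul]

theorem fourier_derivCLM_apply (φ : 𝓢(ℝ, ℂ)) (w : ℝ) :
    𝓕 (SchwartzMap.derivCLM ℂ ℂ φ) w = 2 * Real.pi * Complex.I * w * 𝓕 φ w := by
  have h := Real.fourier_deriv φ.integrable φ.differentiable
    (SchwartzMap.derivCLM ℂ ℂ φ).integrable
  exact congrFun h w

/-- Differentiate the transform of `φ'` in two ways: as `2πi w 𝓕φ` by the product rule, and as the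
transform of `-2πi x φ'`. -/
theorem mul_deriv_fourier (φ : 𝓢(ℝ, ℂ)) (w : ℝ) :
    w * deriv (𝓕 φ : 𝓢(ℝ, ℂ)) w = -(𝓕 φ w + 𝓕 (mulDeriv φ) w) := by
  set ψ := SchwartzMap.derivCLM ℂ ℂ φ with hψ
  have hsm : (fun x : ℝ => x • ψ x) = mulDeriv φ := by
    ext x
    rw [mulDeriv_apply, hψ, SchwartzMap.derivCLM_apply, Complex.real_smul]
  have h1 := Real.hasDerivAt_fourier ψ.integrable (hsm ▸ (mulDeriv φ).integrable) w
  have h2 : HasDerivAt (𝓕 ψ : 𝓢(ℝ, ℂ))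
      (2 * Real.pi * Complex.I * (𝓕 φ w + w * deriv (𝓕 φ : 𝓢(ℝ, ℂ)) w)) w := by
    have h3 := ((𝓕 φ : 𝓢(ℝ, ℂ)).differentiable w).hasDerivAt
    have h4 := (((hasDerivAt_id' w).ofReal_comp.fun_mul h3).const_mul (2 * Real.pi * Complex.I))
    refine (h4.congr_of_eventuallyEq (.of_forall fun y => ?_)).congr_deriv ?_
    · rw [fourier_derivCLM_apply]; ring
    · simp
  have h5 : 𝓕 (fun x : ℝ => (-2 * Real.pi * Complex.I * x) • ψ x) w
      = -2 * Real.pi * Complex.I * 𝓕 (mulDeriv φ) w := by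
    have : (fun x : ℝ => (-2 * Real.pi * Complex.I * x) • ψ x) =
        (-2 * Real.pi * Complex.I : ℂ) • ((mulDeriv φ : 𝓢(ℝ, ℂ)) : ℝ → ℂ) := by
      rw [← hsm]; ext x
      simp [mul_assoc]
    rw [this]
    change 𝓕 ((-2 * Real.pi * Complex.I : ℂ) • mulDeriv φ) w = _
    rw [FourierTransform.fourier_smul]
    rfl
  have h6 := h2.unique h1
  rw [h5] at h6
  have hpi : (2 * Real.pi * Complex.I : ℂ) ≠ 0 := Complex.two_pi_I_ne_zero
  have h7 := mul_left_cancel₀ hpi (h6.trans (by ring :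
    _ = 2 * Real.pi * Complex.I * (-𝓕 (mulDeriv φ) w)))
  linear_combination h7

theorem integrable_norm_sq (φ : 𝓢(ℝ, ℂ)) : Integrable fun x => ‖φ x‖ ^ 2 :=
  (memLp_two_iff_integrable_sq_norm φ.continuous.aestronglyMeasurable).1 (φ.memLp 2)

theorem eLpNorm_two_schwartz (φ : 𝓢(ℝ, ℂ)) :
    eLpNorm φ 2 volume = ENNReal.ofReal √(∫ x, ‖φ x‖ ^ 2) := by
  rw [MemLp.eLpNorm_eq_integral_rpow_norm two_ne_zero ENNReal.ofNat_ne_top (φ.memLp 2 volume),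
    Real.sqrt_eq_rpow]
  norm_num

theorem frequencyDensity_fourier_le (φ : 𝓢(ℝ, ℂ)) (w : ℝ) :
    frequencyDensity (𝓕 φ : 𝓢(ℝ, ℂ)) w ≤ 3 * ‖𝓕 φ w‖ ^ 2 +
      ‖𝓕 (SchwartzMap.derivCLM ℂ ℂ φ) w‖ ^ 2 + 2 * ‖𝓕 (mulDeriv φ) w‖ ^ 2 := by
  have h1 : ‖w * 𝓕 φ w‖ ≤ ‖𝓕 (SchwartzMap.derivCLM ℂ ℂ φ) w‖ := by
    rw [fourier_derivCLM_apply, show 2 * Real.pi * Complex.I * w * 𝓕 φ w =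
      2 * Real.pi * Complex.I * (w * 𝓕 φ w) by ring, norm_mul (2 * Real.pi * Complex.I)]
    refine le_mul_of_one_le_left (norm_nonneg _) ?_
    simp only [norm_mul, Complex.norm_ofNat, Complex.norm_real, Complex.norm_I, mul_one,
      Real.norm_of_nonneg Real.pi_pos.le]
    linarith [Real.pi_gt_three]
  have h1' : ‖w * 𝓕 φ w‖ ^ 2 ≤ ‖𝓕 (SchwartzMap.derivCLM ℂ ℂ φ) w‖ ^ 2 := by gcongr
  have h2 : ‖w * deriv (𝓕 φ : 𝓢(ℝ, ℂ)) w‖ ≤ ‖𝓕 φ w‖ + ‖𝓕 (mulDeriv φ) w‖ := by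
    rw [mul_deriv_fourier, norm_neg]
    exact norm_add_le _ _
  have h2' : ‖w * deriv (𝓕 φ : 𝓢(ℝ, ℂ)) w‖ ^ 2 ≤ (‖𝓕 φ w‖ + ‖𝓕 (mulDeriv φ) w‖) ^ 2 := by gcongr
  have h3 := sq_nonneg (‖𝓕 φ w‖ - ‖𝓕 (mulDeriv φ) w‖)
  unfold frequencyDensity
  linarith

theorem integrable_and_integral_frequencyDensity_fourier_le (φ : 𝓢(ℝ, ℂ)) :
    Integrable (frequencyDensity (𝓕 φ : 𝓢(ℝ, ℂ))) ∧
      ∫ w, frequencyDensity (𝓕 φ : 𝓢(ℝ, ℂ)) w ≤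
        3 * ((∫ x, ‖φ x‖ ^ 2) + (∫ x, ‖deriv φ x‖ ^ 2) + ∫ x, ‖x * deriv φ x‖ ^ 2) := by
  have i1 := (integrable_norm_sq (𝓕 φ)).const_mul 3
  have i2 := integrable_norm_sq (𝓕 (SchwartzMap.derivCLM ℂ ℂ φ))
  have i3 := (integrable_norm_sq (𝓕 (mulDeriv φ))).const_mul 2
  have hb := (i1.add i2).add i3
  have hm : Measurable (frequencyDensity (𝓕 φ : 𝓢(ℝ, ℂ))) := by
    unfold frequencyDensity
    have := (𝓕 φ : 𝓢(ℝ, ℂ)).continuous.measurable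
    fun_prop
  have hi : Integrable (frequencyDensity (𝓕 φ : 𝓢(ℝ, ℂ))) :=
    hb.mono' hm.aestronglyMeasurable (.of_forall fun w => by
      rw [Real.norm_of_nonneg (frequencyDensity_nonneg _ w)]
      exact frequencyDensity_fourier_le φ w)
  refine ⟨hi, (integral_mono hi hb (frequencyDensity_fourier_le φ)).trans ?_⟩
  rw [integral_add' (i1.add i2) i3, integral_add' i1 i2, integral_const_mul, integral_const_mul,
    SchwartzMap.integral_norm_sq_fourier, SchwartzMap.integral_norm_sq_fourier,
    SchwartzMap.integral_norm_sq_fourier]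
  simp only [mulDeriv_apply, SchwartzMap.derivCLM_apply]
  have h2 : 0 ≤ ∫ x, ‖deriv φ x‖ ^ 2 := integral_nonneg fun x => by positivity
  have h3 : 0 ≤ ∫ x : ℝ, ‖x * deriv φ x‖ ^ 2 := integral_nonneg fun x => by positivity
  linarith

/-! ### Pointwise bound for the propagator and the norms -/

theorem Phi_two_pi_mul_sq {η : ℝ} (hη : 0 < η) : Phi (2 * Real.pi * η ^ 2) = √(2 * Real.pi) * η := by
  rw [Phi, abs_of_nonneg (by positivity), ← Real.sqrt_eq_rpow, Real.sqrt_mul (by positivity),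
    Real.sqrt_sq hη.le]

theorem Phi_neg (ξ : ℝ) : Phi (-ξ) = Phi ξ := by rw [Phi, abs_neg, Phi]

theorem frequencyDensity_comp_neg (F : ℝ → ℂ) (w : ℝ) :
    frequencyDensity (fun w => F (-w)) w = frequencyDensity F (-w) := by
  simp [frequencyDensity, deriv_comp_neg]

/-- Both half-lines reduce to the same estimate, since `Phi` is even and reflection only changes the
sign of `X`. The condition `x ≠ 0` keeps the phase genuinely quadratic. The constant is `832 = 2 ·
208 · 2`: two half-lines, and `M = 2m`. -/
theorem norm_propagator_le (t : ℝ) (φ : 𝓢(ℝ, ℂ)) {m : ℝ} (hm : 0 < m)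
    (hle : (∫ x, ‖φ x‖ ^ 2) + (∫ x, ‖deriv φ x‖ ^ 2) + ∫ x, ‖x * deriv φ x‖ ^ 2 ≤ m ^ 2)
    {x : ℝ} (hx : x ≠ 0) :
    ‖propagator t φ x‖ ≤ 832 * (1 + |t|) ^ (-(1 / 2) : ℝ) * m := by
  obtain ⟨hi, hib⟩ := integrable_and_integral_frequencyDensity_fourier_le φ
  set f : 𝓢(ℝ, ℂ) := 𝓕 φ with hf
  set G : ℝ → ℂ := fun w => Complex.exp (Complex.I * (2 * Real.pi * x * w : ℝ)) *
    (Complex.exp (Complex.I * t * Phi (2 * Real.pi * w)) * f w) with hG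
  have hprop : propagator t φ x = ∫ w, G w := by
    rw [propagator, fourierMultiplier, Real.fourierInv_eq']
    refine integral_congr_ae (.of_forall fun w => ?_)
    simp only [hG, hf, smul_eq_mul, SchwartzMap.fourier_coe]
    congr 2
    simp only [RCLike.inner_apply, conj_trivial]
    push_cast
    ring
  have hGi : Integrable G := by
    refine (integrable_symbol_mul_fourier t φ).bdd_mul (c := 1)
      (Continuous.aestronglyMeasurable (by fun_prop)) (.of_forall fun w => ?_)
    rw [mul_comm Complex.I, Complex.norm_exp_ofReal_mul_I]
  -- The Plancherel constant `3` is absorbed by `3m² ≤ (2m)²`.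
  have htot : ∀ S : Set ℝ, ∫ w in S, frequencyDensity f w ≤ (2 * m) ^ 2 := fun S =>
    (setIntegral_le_integral hi (.of_forall (frequencyDensity_nonneg f))).trans
      (hib.trans (by nlinarith))
  have hm2 : 0 < 2 * m := by linarith
  have hpos : ‖∫ w in Ioi 0, G w‖ ≤
      208 * (2 * m) * (1 + |√(2 * Real.pi) * t|) ^ (-(1 / 2) : ℝ) := by
    refine norm_integral_Ioi_le (F := f) (f.smooth 1) hi.integrableOn hm2 (htot _)
      (X := 2 * Real.pi * x) (by positivity) fun η hη => ?_
    simp only [hG]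
    rw [← mul_assoc, ← Complex.exp_add, Phi_two_pi_mul_sq hη]
    congr 2
    push_cast
    ring
  have hneg : ‖∫ w in Ioi 0, G (-w)‖ ≤
      208 * (2 * m) * (1 + |√(2 * Real.pi) * t|) ^ (-(1 / 2) : ℝ) := by
    have hfd : frequencyDensity (fun w => f (-w)) = fun w => frequencyDensity f (-w) :=
      funext (frequencyDensity_comp_neg f)
    refine norm_integral_Ioi_le (F := fun w => f (-w)) ((f.smooth 1).comp contDiff_neg)
      ?_ hm2 ?_ (X := -(2 * Real.pi * x)) (neg_ne_zero.2 (by positivity)) fun η hη => ?_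
    · rw [hfd]; exact hi.comp_neg.integrableOn
    · rw [hfd, integral_comp_neg_Ioi (f := frequencyDensity f)]; exact htot _
    · simp only [hG]
      rw [← mul_assoc, ← Complex.exp_add, mul_neg (2 * Real.pi) (η ^ 2), Phi_neg,
        Phi_two_pi_mul_sq hη]
      congr 2
      push_cast
      ring
  have hdecay : (1 + |√(2 * Real.pi) * t|) ^ (-(1 / 2) : ℝ) ≤ (1 + |t|) ^ (-(1 / 2) : ℝ) := by
    refine Real.rpow_le_rpow_of_nonpos (by positivity) ?_ (by norm_num)
    rw [abs_mul, abs_of_nonneg (Real.sqrt_nonneg _)]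
    have : 1 ≤ √(2 * Real.pi) := Real.one_le_sqrt.2 (by linarith [Real.pi_gt_three])
    nlinarith [abs_nonneg t]
  rw [integral_comp_neg_Ioi (f := G), neg_zero] at hneg
  rw [hprop, ← intervalIntegral.integral_Iic_add_Ioi (b := 0) hGi.integrableOn hGi.integrableOn]
  calc _ ≤ _ := norm_add_le _ _
    _ ≤ 208 * (2 * m) * (1 + |√(2 * Real.pi) * t|) ^ (-(1 / 2) : ℝ) +
        208 * (2 * m) * (1 + |√(2 * Real.pi) * t|) ^ (-(1 / 2) : ℝ) := add_le_add hneg hpos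
    _ ≤ 208 * (2 * m) * (1 + |t|) ^ (-(1 / 2) : ℝ) +
        208 * (2 * m) * (1 + |t|) ^ (-(1 / 2) : ℝ) := by gcongr
    _ = _ := by ring

theorem h1Norm_eq (φ : 𝓢(ℝ, ℂ)) : h1Norm φ =
    ENNReal.ofReal √((∫ x, ‖φ x‖ ^ 2) + ∫ x, ‖deriv φ x‖ ^ 2) := by
  have h1 : 0 ≤ ∫ x, ‖φ x‖ ^ 2 := integral_nonneg fun x => by positivity
  have h2 : 0 ≤ ∫ x, ‖deriv φ x‖ ^ 2 := integral_nonneg fun x => by positivity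
  have hd := eLpNorm_two_schwartz (SchwartzMap.derivCLM ℂ ℂ φ)
  simp only [SchwartzMap.derivCLM_apply] at hd
  replace hd : eLpNorm (deriv φ) 2 volume = ENNReal.ofReal √(∫ x, ‖deriv φ x‖ ^ 2) := hd
  rw [h1Norm, hd, eLpNorm_two_schwartz, ← ENNReal.ofReal_pow (Real.sqrt_nonneg _),
    ← ENNReal.ofReal_pow (Real.sqrt_nonneg _), Real.sq_sqrt h1, Real.sq_sqrt h2,
    ← ENNReal.ofReal_add h1 h2, ENNReal.ofReal_rpow_of_nonneg (by positivity) (by norm_num),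
    Real.sqrt_eq_rpow]

theorem weightedNorm_eq (φ : 𝓢(ℝ, ℂ)) :
    weightedNorm φ = ENNReal.ofReal √(∫ x : ℝ, ‖x * deriv φ x‖ ^ 2) := by
  have hd := eLpNorm_two_schwartz (mulDeriv φ)
  rw [show (mulDeriv φ : ℝ → ℂ) = fun x : ℝ => (x : ℂ) * deriv φ x from
    funext (mulDeriv_apply φ)] at hd
  exact hd

end WaterWave

end

/-- The estimate is an inequality in `[0, ∞]`; the right-hand side is finite for Schwartz `φ`. -/
theorem theorem1 :
    ∃ C : ℝ, 0 < C ∧ ∀ (t : ℝ) (φ : 𝓢(ℝ, ℂ)),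
      eLpNorm (WaterWave.propagator t φ) ∞ volume ≤
        ENNReal.ofReal (C * (1 + |t|) ^ (-(1 / 2) : ℝ)) *
          (WaterWave.h1Norm φ + WaterWave.weightedNorm φ) := by
  refine ⟨832, by norm_num, fun t φ => ?_⟩
  set A := (∫ x, ‖φ x‖ ^ 2) + ∫ x, ‖deriv φ x‖ ^ 2 with hA
  set B := ∫ x : ℝ, ‖x * deriv φ x‖ ^ 2 with hB
  have hA0 : 0 ≤ A := add_nonneg (integral_nonneg fun x => by positivity)
    (integral_nonneg fun x => by positivity)
  have hB0 : 0 ≤ B := integral_nonneg fun x => by positivity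
  rw [WaterWave.h1Norm_eq, WaterWave.weightedNorm_eq, ← hA, ← hB,
    ← ENNReal.ofReal_add (Real.sqrt_nonneg _) (Real.sqrt_nonneg _),
    ← ENNReal.ofReal_mul (by positivity), eLpNorm_exponent_top]
  refine eLpNormEssSup_le_of_ae_bound ?_
  -- The point `x = 0`, where the phase has no quadratic term, is a null set for the essential
  -- supremum.
  filter_upwards [compl_mem_ae_iff.2 (measure_singleton (μ := volume) (0 : ℝ))] with x hx
  -- The pointwise bound needs `m > 0`, while `√A + √B` may vanish; take `m = √A + √B + ε` and let
  -- `ε` tend to `0`.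
  have hlim : Filter.Tendsto
      (fun ε : ℝ => 832 * (1 + |t|) ^ (-(1 / 2) : ℝ) * (√A + √B + ε)) (nhdsWithin 0 (Set.Ioi 0))
      (nhds (832 * (1 + |t|) ^ (-(1 / 2) : ℝ) * (√A + √B + 0))) :=
    ((Continuous.tendsto (by fun_prop) 0).mono_left nhdsWithin_le_nhds)
  rw [add_zero] at hlim
  refine ge_of_tendsto hlim (Filter.eventually_of_mem self_mem_nhdsWithin fun ε hε => ?_)
  have hε0 : 0 < ε := hε
  have hsA := Real.sqrt_nonneg A
  have hsB := Real.sqrt_nonneg B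
  refine WaterWave.norm_propagator_le t φ (by positivity) ?_ hx
  calc A + B = √A ^ 2 + √B ^ 2 := by rw [Real.sq_sqrt hA0, Real.sq_sqrt hB0]
    _ ≤ (√A + √B + ε) ^ 2 := by
      nlinarith [mul_nonneg hsA hsB, mul_nonneg hsA hε0.le, mul_nonneg hsB hε0.le, sq_nonneg ε]
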